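/- Let $s\ge 2$. Let $\mathcal P_s$ be the space of positive definite quadratic forms of determinant one on $\mathbb R^s$ (identified with their matrices), with the distance $d(Q_1,Q_2)=\sqrt{\sum_i(\ln\lambda_i)^2}$, where $\lambda_1,\dots,\lambda_s$ are the coefficients of $Q_2$ in a $Q_1$-orthonormal basis diagonalizing $Q_2$ (equivalently, the eigenvalues of $Q_1^{-1}Q_2$ with multiplicity). The group $SL(s,\mathbb R)$ acts on the right on $\mathcal P_s$ by $Q\,g=g^TQg$; let $\mathcal T_s=\mathcal P_s/SL(s,\mathbb Z)$, with the quotient distance, and let $\mathrm{proj}:\mathcal P_s\to\mathcal T_s$ be the projection. For $1\le i\le s-1$ put $\lambda_i=\sqrt{\frac{i}{s(s-i)}}$, $\mu_i=\sqrt{\frac{s-i}{si}}$, $v_i=(\lambda_i,\dots,\lambda_i,-\mu_i,\dots,-\mu_i)\in\mathbb R^s$ with $s-i$ entries $\lambda_i$ and $i$ entries $-\mu_i$, and let $$r_i(t)=\mathrm{diag}(e^{\lambda_it},\dots,e^{\lambda_it},e^{-\mu_it},\dots,e^{-\mu_it}),\qquad \bar r_i=\mathrm{proj}\circ r_i ,$$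 with the same multiplicities. Let $\bar f_i(x)=\lim_{t\to\infty}[\mathrm{dist}(x,\bar r_i(t))-t]$ be the Busemann function of $\bar r_i$ on $\mathcal T_s$. Let $\eta=\sqrt{\frac{s}{s-1}}$. Let $1\le m\le s-1$, write $\lambda=\lambda_m$ and $\mu=\mu_m$, and let $$U_+(r_m)=\left\{\begin{pmatrix}Id_{s-m}&N\\0&Id_m\end{pmatrix};\ N\in M_{(s-m)\times m}(\mathbb R)\right\}.$$ For $k\in\{1,s-1\}$ and a real function $\varphi$ defined on a half-line $[a,+\infty)$, let $$\mathcal R^k_\varphi=\left\{\mathbf u\in U_+(r_m);\ -\bar f_k(\mathrm{proj}(r_m(t)\mathbf u))\ge\alpha_kt-\varphi(t)\ \text{ for arbitrarily large } t\right\},\qquad \alpha_k=\langle v_k|v_m\rangle .$$ Then there are constants $C$ and $C'$, depending only on $s$, such that for every $m\in\{1,\dots,s-1\}$ the following hold. 1. For every strictly increasing function $\varphi:[a,+\infty)\to[b,+\infty)$ one has $\mathcal R^1_\varphi\subset\mathcal R^{s-1}_\psi$ with $$\psi(t)=\eta\left(\lambda-\frac{\mu}{s-1}\right)t+\frac1{s-1}\varphi(t)+C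 .$$ 2. Conversely, for every strictly increasing function $\psi:[a',+\infty)\to[b',+\infty)$ one has $\mathcal R^{s-1}_\psi\subset\mathcal R^1_\varphi$ with $$\varphi(t)=\eta\left(\mu-\frac{\lambda}{s-1}\right)t+\frac1{s-1}\psi(t)+C' .$$ -/

import Mathlib

open Filter Set
open scoped Matrix

namespace Transference

noncomputable section

/-- `λ_i = √(i / (s (s - i)))`. -/
def lam (s i : ℕ) : ℝ := Real.sqrt ((i : ℝ) / ((s : ℝ) * ((s : ℝ) - (i : ℝ))))

/-- `μ_i = √((s - i) / (s i))`. -/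
def mu (s i : ℕ) : ℝ := Real.sqrt (((s : ℝ) - (i : ℝ)) / ((s : ℝ) * (i : ℝ)))

/-- `η = √(s / (s - 1))`. -/
def eta (s : ℕ) : ℝ := Real.sqrt ((s : ℝ) / ((s : ℝ) - 1))

/-- The vector `v_i = (λ_i, …, λ_i, -μ_i, …, -μ_i)`, with `s - i` entries `λ_i` followed by
`i` entries `-μ_i`. -/
def vec (s i : ℕ) : Fin s → ℝ := fun j => if (j : ℕ) < s - i then lam s i else -mu s i

/-- The entries of `v_i` add up to zero. -/
theorem sum_vec (s i : ℕ) (hi : i < s) : ∑ j, vec s i j = 0 := by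
  have hs : (0 : ℝ) < s := by exact_mod_cast (by omega : 0 < s)
  have hsi : (0 : ℝ) < (s : ℝ) - i := sub_pos.2 (by exact_mod_cast hi)
  have hsplit : ∑ j, vec s i j = ((s : ℝ) - i) * lam s i - i * mu s i := by
    have h1 : ∑ j, vec s i j
        = ∑ j ∈ Finset.range s, (if j < s - i then lam s i else -mu s i) :=
      Fin.sum_univ_eq_sum_range (fun j => if j < s - i then lam s i else -mu s i) s
    have h2 : s = (s - i) + i := by omega
    have h3 : ((s - i : ℕ) : ℝ) = (s : ℝ) - i := Nat.cast_sub hi.le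
    rw [h1]
    conv_lhs => rw [show Finset.range s = Finset.range ((s - i) + i) from congrArg _ h2]
    rw [Finset.sum_range_add]
    rw [Finset.sum_congr rfl (g := fun _ => lam s i)
      (fun j hj => if_pos (Finset.mem_range.1 hj))]
    rw [Finset.sum_congr (s₂ := Finset.range i) rfl (g := fun _ => -mu s i)
      (fun j _ => if_neg (by omega))]
    simp only [Finset.sum_const, Finset.card_range, nsmul_eq_mul, h3]
    ring
  rw [hsplit]
  rcases Nat.eq_zero_or_pos i with h0 | h0
  · subst h0
    simp [lam]
  have hi0 : (0 : ℝ) < i := by exact_mod_cast h0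
  have e1 : ((s : ℝ) - i) * lam s i = Real.sqrt (((s : ℝ) - i) * i / s) := by
    unfold lam
    rw [← Real.sqrt_sq hsi.le, ← Real.sqrt_mul (sq_nonneg _), Real.sqrt_sq hsi.le]
    congr 1
    field_simp
  have e2 : (i : ℝ) * mu s i = Real.sqrt (((s : ℝ) - i) * i / s) := by
    unfold mu
    rw [← Real.sqrt_sq hi0.le, ← Real.sqrt_mul (sq_nonneg _), Real.sqrt_sq hi0.le]
    congr 1
    field_simp
  rw [e1, e2, sub_self]

/-- The space `𝒫_s` of positive definite quadratic forms of determinant one on `ℝ^s`,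
a form being identified with its matrix in the canonical basis. -/
def PosForm (s : ℕ) : Type := {Q : Matrix (Fin s) (Fin s) ℝ // Q.PosDef ∧ Q.det = 1}

/-- The distance of `𝒫_s`: if a basis is orthonormal for `Q₁` and diagonalizes `Q₂` with
coefficients `λ_1, …, λ_s`, then `d(Q₁, Q₂) = √(∑ (ln λ_i)²)`. These coefficients are the
eigenvalues of `Q₁⁻¹ Q₂`, with multiplicity. -/
def formDist {s : ℕ} (Q₁ Q₂ : PosForm s) : ℝ :=
  Real.sqrt (((Q₁.1⁻¹ * Q₂.1).charpoly.roots.map fun x => (Real.log x) ^ 2).sum)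

/-- The right action of `SL(s, ℝ)` on `𝒫_s`, `Q ↦ gᵀ Q g`. -/
def act {s : ℕ} (Q : PosForm s) (g : Matrix.SpecialLinearGroup (Fin s) ℝ) : PosForm s :=
  ⟨g.1ᵀ * Q.1 * g.1, by
    have hinj : Function.Injective g.1.mulVec :=
      Matrix.mulVec_injective_iff_isUnit.2
        ((Matrix.isUnit_iff_isUnit_det _).2 (by rw [g.2]; exact isUnit_one))
    simpa using Q.2.1.conjTranspose_mul_mul_same hinj, by
    rw [Matrix.det_mul, Matrix.det_mul, Matrix.det_transpose, g.2, Q.2.2]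
    norm_num⟩

theorem act_one {s : ℕ} (Q : PosForm s) : act Q 1 = Q :=
  Subtype.ext (by simp [act])

theorem act_mul {s : ℕ} (Q : PosForm s) (g h : Matrix.SpecialLinearGroup (Fin s) ℝ) :
    act Q (g * h) = act (act Q g) h :=
  Subtype.ext (by simp [act, Matrix.transpose_mul, Matrix.mul_assoc])

/-- The inclusion of `SL(s, ℤ)` in `SL(s, ℝ)`. -/
def toReal (s : ℕ) :
    Matrix.SpecialLinearGroup (Fin s) ℤ →* Matrix.SpecialLinearGroup (Fin s) ℝ :=
  Matrix.SpecialLinearGroup.map (Int.castRingHom ℝ)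

/-- Two forms are equivalent when they are in the same `SL(s, ℤ)`-orbit. -/
def formSetoid (s : ℕ) : Setoid (PosForm s) where
  r Q₁ Q₂ := ∃ γ : Matrix.SpecialLinearGroup (Fin s) ℤ, act Q₁ (toReal s γ) = Q₂
  iseqv :=
    { refl := fun Q => ⟨1, by rw [map_one, act_one]⟩
      symm := by
        rintro Q₁ _ ⟨γ, rfl⟩
        exact ⟨γ⁻¹, by rw [← act_mul, ← map_mul, mul_inv_cancel, map_one, act_one]⟩
      trans := by
        rintro Q₁ _ _ ⟨γ, rfl⟩ ⟨δ, rfl⟩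
        exact ⟨γ * δ, by rw [map_mul, act_mul]⟩ }

/-- The locally symmetric space `𝒯_s = 𝒫_s / SL(s, ℤ)`. -/
def LocSym (s : ℕ) : Type := Quotient (formSetoid s)

/-- The projection `𝒫_s → 𝒯_s`. -/
def proj {s : ℕ} (Q : PosForm s) : LocSym s := Quotient.mk (formSetoid s) Q

/-- The quotient distance on `𝒯_s`: the infimum of the distances between lifts. -/
def quotDist {s : ℕ} (x y : LocSym s) : ℝ :=
  sInf {d : ℝ | ∃ Q₁ Q₂ : PosForm s, proj Q₁ = x ∧ proj Q₂ = y ∧ formDist Q₁ Q₂ = d}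

/-- The Busemann function `x ↦ lim_{t → ∞} [dist (x, r t) - t]` of a ray `r` in a space with
distance function `dist`. -/
def busemann {X : Type*} (dist : X → X → ℝ) (r : ℝ → X) (x : X) : ℝ :=
  limUnder atTop fun t : ℝ => dist x (r t) - t

/-- The ray `r_i(t) = diag(e^{λ_i t}, …, e^{λ_i t}, e^{-μ_i t}, …, e^{-μ_i t})` of `𝒫_s`, with
`s - i` entries of the first kind and `i` of the second. -/
def ray (s i : ℕ) (hi : i < s) (t : ℝ) : PosForm s :=
  ⟨Matrix.diagonal fun j => Real.exp (vec s i j * t),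
    Matrix.PosDef.diagonal fun _ => Real.exp_pos _, by
    rw [Matrix.det_diagonal, ← Real.exp_sum, ← Finset.sum_mul, sum_vec s i hi, zero_mul,
      Real.exp_zero]⟩

/-- `f̄_i`, the Busemann function on `𝒯_s` of the projection `r̄_i` of the ray `r_i`. -/
def fbar (s i : ℕ) (hi : i < s) : LocSym s → ℝ :=
  busemann quotDist fun t => proj (ray s i hi t)

/-- The group `U_+(r_i)` of the matrices `(Id_{s-i}, N; 0, Id_i)`, with `N` an arbitrary
`(s - i) × i` block. -/
def oppUnipotent (s i : ℕ) : Set (Matrix.SpecialLinearGroup (Fin s) ℝ) :=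
  {u | ∀ j k : Fin s, ¬((j : ℕ) < s - i ∧ s - i ≤ (k : ℕ)) →
    u.1 j k = (1 : Matrix (Fin s) (Fin s) ℝ) j k}

/-- `α_k = ⟨v_k | v_m⟩`. -/
def alpha (s m k : ℕ) : ℝ := vec s k ⬝ᵥ vec s m

/-- The set `ℛ_φ^k` of the unipotents `u ∈ U_+(r_m)` such that
`-f̄_k(proj(r_m(t) u)) ≥ α_k t - φ(t)` infinitely many times as `t → ∞`, that is, for
arbitrarily large `t`. -/
def ascending (s m : ℕ) (hm : m < s) (k : ℕ) (hk : k < s) (φ : ℝ → ℝ) :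
    Set (Matrix.SpecialLinearGroup (Fin s) ℝ) :=
  {u | u ∈ oppUnipotent s m ∧
    ∃ᶠ t in atTop, alpha s m k * t - φ t ≤ -fbar s k hk (proj (act (ray s m hm t) u))}

end

end Transference

namespace Transference

open scoped MatrixOrder Matrix.Norms.L2Operator in
/-- Two forms of determinant one are simultaneously diagonalizable. -/
theorem exists_simultaneous_diagonalization {s : ℕ} (Q₁ Q₂ : PosForm s) :
    ∃ (P : Matrix (Fin s) (Fin s) ℝ) (x : Fin s → ℝ), (∀ i, 0 < x i) ∧
      Pᵀ * Q₁.1 * P = 1 ∧ Pᵀ * Q₂.1 * P = Matrix.diagonal x := by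
  obtain ⟨B, hB⟩ := CStarAlgebra.nonneg_iff_eq_star_mul_self.mp
    (Matrix.nonneg_iff_posSemidef.2 Q₁.2.1.posSemidef)
  rw [Matrix.star_eq_conjTranspose, Matrix.conjTranspose_eq_transpose_of_trivial] at hB
  have hBdet : IsUnit B.det := by
    refine isUnit_iff_ne_zero.2 fun h => ?_
    have := Q₁.2.2
    rw [hB, Matrix.det_mul, h, mul_zero] at this
    exact zero_ne_one this
  have hBB : B * B⁻¹ = 1 := Matrix.mul_nonsing_inv B hBdet
  have hinj : Function.Injective (B⁻¹).mulVec :=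
    Matrix.mulVec_injective_iff_isUnit.2 (Matrix.isUnit_nonsing_inv_iff.2
      ((Matrix.isUnit_iff_isUnit_det _).2 hBdet))
  have hA : ((B⁻¹)ᵀ * Q₂.1 * B⁻¹).PosDef := by
    simpa using Q₂.2.1.conjTranspose_mul_mul_same hinj
  set U : Matrix (Fin s) (Fin s) ℝ := hA.1.eigenvectorUnitary.1 with hU
  have hUU : Uᵀ * U = 1 := by
    have := Unitary.coe_star_mul_self hA.1.eigenvectorUnitary
    simpa [Matrix.star_eq_conjTranspose] using this
  refine ⟨B⁻¹ * U, hA.1.eigenvalues, hA.eigenvalues_pos, ?_, ?_⟩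
  · calc (B⁻¹ * U)ᵀ * Q₁.1 * (B⁻¹ * U) = Uᵀ * ((B * B⁻¹)ᵀ * (B * B⁻¹)) * U := by
          rw [hB]; simp only [Matrix.transpose_mul, Matrix.mul_assoc]
      _ = 1 := by rw [hBB]; simp [hUU]
  · have h := hA.1.conjStarAlgAut_star_eigenvectorUnitary
    rw [Unitary.conjStarAlgAut_star_apply] at h
    rw [Matrix.star_eq_conjTranspose, Matrix.conjTranspose_eq_transpose_of_trivial] at h
    have h2 : (RCLike.ofReal ∘ hA.1.eigenvalues : Fin s → ℝ) = hA.1.eigenvalues := rfl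
    rw [h2] at h
    rw [← h, ← hU]
    simp only [Matrix.transpose_mul, Matrix.mul_assoc]

/-- The coefficients of `Q₂` in a `Q₁`-orthonormal basis which diagonalizes it, with the
invariants of the pair which they determine. -/
theorem exists_coefficients {s : ℕ} (Q₁ Q₂ : PosForm s) :
    ∃ x : Fin s → ℝ, (∀ i, 0 < x i) ∧ ∑ i, Real.log (x i) = 0 ∧
      formDist Q₁ Q₂ = Real.sqrt (∑ i, Real.log (x i) ^ 2) ∧
      formDist Q₂ Q₁ = Real.sqrt (∑ i, Real.log (x i) ^ 2) ∧
      (Q₁.1⁻¹ * Q₂.1).trace = ∑ i, x i ∧ (Q₂.1⁻¹ * Q₁.1).trace = ∑ i, (x i)⁻¹ ∧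
      (∀ v : Fin s → ℝ, ∃ c : Fin s → ℝ, v ⬝ᵥ Q₁.1 *ᵥ v = ∑ i, c i ^ 2 ∧
        v ⬝ᵥ Q₂.1 *ᵥ v = ∑ i, x i * c i ^ 2) := by
  obtain ⟨P, x, hx, h1, h2⟩ := exists_simultaneous_diagonalization Q₁ Q₂
  have hdet : P.det * P.det = 1 := by
    have := congrArg Matrix.det h1
    simpa [Matrix.det_mul, Q₁.2.2] using this
  have hprod : ∏ i, x i = 1 := by
    have := congrArg Matrix.det h2
    rw [Matrix.det_mul, Matrix.det_mul, Matrix.det_transpose, Q₂.2.2, mul_one, hdet,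
      Matrix.det_diagonal] at this
    exact this.symm
  have hPdet : IsUnit P.det := IsUnit.of_mul_eq_one _ hdet
  have hPP : P * P⁻¹ = 1 := Matrix.mul_nonsing_inv P hPdet
  have hPP' : P⁻¹ * P = 1 := Matrix.nonsing_inv_mul P hPdet
  have hT : (P⁻¹)ᵀ * Pᵀ = 1 := by rw [← Matrix.transpose_mul, hPP, Matrix.transpose_one]
  have e1 : Q₁.1 = (P⁻¹)ᵀ * P⁻¹ := by
    calc Q₁.1 = ((P⁻¹)ᵀ * Pᵀ) * Q₁.1 * (P * P⁻¹) := by rw [hT, hPP]; simp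
      _ = (P⁻¹)ᵀ * (Pᵀ * Q₁.1 * P) * P⁻¹ := by simp only [Matrix.mul_assoc]
      _ = _ := by rw [h1]; simp
  have e2 : Q₂.1 = (P⁻¹)ᵀ * Matrix.diagonal x * P⁻¹ := by
    calc Q₂.1 = ((P⁻¹)ᵀ * Pᵀ) * Q₂.1 * (P * P⁻¹) := by rw [hT, hPP]; simp
      _ = (P⁻¹)ᵀ * (Pᵀ * Q₂.1 * P) * P⁻¹ := by simp only [Matrix.mul_assoc]
      _ = _ := by rw [h2]
  have i1 : Q₁.1⁻¹ = P * Pᵀ := by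
    refine Matrix.inv_eq_left_inv ?_
    rw [e1, Matrix.mul_assoc, ← Matrix.mul_assoc Pᵀ, ← Matrix.transpose_mul, hPP']
    simp [hPP]
  have hxx : Matrix.diagonal (fun i => (x i)⁻¹) * Matrix.diagonal x = 1 := by
    rw [Matrix.diagonal_mul_diagonal, ← Matrix.diagonal_one]
    congr 1
    funext i
    exact inv_mul_cancel₀ (hx i).ne'
  have hT' : Pᵀ * (P⁻¹)ᵀ = 1 := by rw [← Matrix.transpose_mul, hPP', Matrix.transpose_one]
  have i2 : Q₂.1⁻¹ = P * Matrix.diagonal (fun i => (x i)⁻¹) * Pᵀ := by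
    refine Matrix.inv_eq_left_inv ?_
    calc P * Matrix.diagonal (fun i => (x i)⁻¹) * Pᵀ * Q₂.1
        = P * (Matrix.diagonal (fun i => (x i)⁻¹) * (Pᵀ * (P⁻¹)ᵀ) * Matrix.diagonal x) * P⁻¹ := by
          rw [e2]; simp only [Matrix.mul_assoc]
      _ = 1 := by rw [hT', Matrix.mul_one, hxx]; simp [hPP]
  have m1 : Q₁.1⁻¹ * Q₂.1 = P * Matrix.diagonal x * P⁻¹ := by
    calc Q₁.1⁻¹ * Q₂.1 = P * (Pᵀ * (P⁻¹)ᵀ) * Matrix.diagonal x * P⁻¹ := by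
          rw [i1, e2]; simp only [Matrix.mul_assoc]
      _ = _ := by rw [hT', Matrix.mul_one]
  have m2 : Q₂.1⁻¹ * Q₁.1 = P * Matrix.diagonal (fun i => (x i)⁻¹) * P⁻¹ := by
    calc Q₂.1⁻¹ * Q₁.1 = P * Matrix.diagonal (fun i => (x i)⁻¹) * (Pᵀ * (P⁻¹)ᵀ) * P⁻¹ := by
          rw [i2, e1]; simp only [Matrix.mul_assoc]
      _ = _ := by rw [hT', Matrix.mul_one]
  have hroots : ∀ y : Fin s → ℝ,
      (P * Matrix.diagonal y * P⁻¹).charpoly.roots = Finset.univ.val.map y := fun y => by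
    rw [Matrix.charpoly_mul_comm, ← Matrix.mul_assoc, hPP', Matrix.one_mul,
      Matrix.charpoly_diagonal, Polynomial.roots_prod]
    · simp
    · simp [Finset.prod_ne_zero_iff, Polynomial.X_sub_C_ne_zero]
  refine ⟨x, hx, ?_, ?_, ?_, ?_, ?_, fun v => ⟨P⁻¹ *ᵥ v, ?_, ?_⟩⟩
  · rw [← Real.log_prod fun i _ => (hx i).ne', hprod, Real.log_one]
  · rw [formDist, m1, hroots, Multiset.map_map]
    rfl
  · rw [formDist, m2, hroots, Multiset.map_map]
    change Real.sqrt (∑ i, Real.log (x i)⁻¹ ^ 2) = _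
    simp only [Real.log_inv, neg_sq]
  · rw [m1, Matrix.trace_mul_comm, ← Matrix.mul_assoc, hPP', Matrix.one_mul,
      Matrix.trace_diagonal]
  · rw [m2, Matrix.trace_mul_comm, ← Matrix.mul_assoc, hPP', Matrix.one_mul,
      Matrix.trace_diagonal]
  · rw [e1, ← Matrix.mulVec_mulVec, Matrix.mulVec_transpose, dotProduct_comm,
      ← Matrix.dotProduct_mulVec]
    simp [dotProduct, sq]
  · rw [e2, ← Matrix.mulVec_mulVec, ← Matrix.mulVec_mulVec, Matrix.mulVec_transpose,
      dotProduct_comm, ← Matrix.dotProduct_mulVec]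
    simp only [dotProduct, Matrix.mulVec_diagonal]
    exact Finset.sum_congr rfl fun i _ => by ring

theorem formDist_comm {s : ℕ} (Q₁ Q₂ : PosForm s) : formDist Q₁ Q₂ = formDist Q₂ Q₁ := by
  obtain ⟨x, -, -, h1, h2, -⟩ := exists_coefficients Q₁ Q₂
  rw [h1, h2]

theorem eta_pos {s : ℕ} (hs : 2 ≤ s) : 0 < eta s := by
  have : (2 : ℝ) ≤ s := by exact_mod_cast hs
  exact Real.sqrt_pos.2 (div_pos (by linarith) (by linarith))

/-- Among the vectors with zero sum, each coordinate is at most `1 / η` times the norm. -/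
theorem eta_mul_abs_le_sqrt {s : ℕ} (hs : 2 ≤ s) (y : Fin s → ℝ) (hy : ∑ i, y i = 0)
    (j : Fin s) : eta s * |y j| ≤ Real.sqrt (∑ i, y i ^ 2) := by
  have h2 : (2 : ℝ) ≤ s := by exact_mod_cast hs
  refine Real.le_sqrt_of_sq_le ?_
  rw [mul_pow, sq_abs, eta, Real.sq_sqrt (div_nonneg (by linarith) (by linarith))]
  have hc := sq_sum_le_card_mul_sum_sq (s := Finset.univ.erase j) (f := y)
  have e1 := Finset.add_sum_erase Finset.univ y (Finset.mem_univ j)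
  have e2 := Finset.add_sum_erase Finset.univ (fun i => y i ^ 2) (Finset.mem_univ j)
  rw [Finset.card_erase_of_mem (Finset.mem_univ j), Finset.card_univ, Fintype.card_fin,
    Nat.cast_sub (by omega), Nat.cast_one] at hc
  rw [hy] at e1
  have e3 : ∑ i ∈ Finset.univ.erase j, y i = - y j := by linarith
  rw [e3, neg_sq] at hc
  rw [← e2, div_mul_eq_mul_div, div_le_iff₀ (by linarith)]
  nlinarith

/-- The logarithms of the values at a given vector are `1 / η`-Lipschitz on `𝒫_s`. -/
theorem eta_mul_log_sub_log_le {s : ℕ} (hs : 2 ≤ s) (Q₁ Q₂ : PosForm s) (v : Fin s → ℝ)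
    (hv : v ≠ 0) :
    eta s * (Real.log (v ⬝ᵥ Q₁.1 *ᵥ v) - Real.log (v ⬝ᵥ Q₂.1 *ᵥ v)) ≤ formDist Q₁ Q₂ := by
  obtain ⟨x, hx, hsum, hd, -, -, -, hval⟩ := exists_coefficients Q₁ Q₂
  obtain ⟨c, h1, h2⟩ := hval v
  have p1 : 0 < v ⬝ᵥ Q₁.1 *ᵥ v := by simpa using Q₁.2.1.dotProduct_mulVec_pos hv
  have p2 : 0 < v ⬝ᵥ Q₂.1 *ᵥ v := by simpa using Q₂.2.1.dotProduct_mulVec_pos hv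
  have he := eta_pos hs
  set D := formDist Q₁ Q₂ / eta s with hD
  have hxD : ∀ i, Real.exp (-D) ≤ x i := fun i => by
    rw [← Real.le_log_iff_exp_le (hx i)]
    have := eta_mul_abs_le_sqrt hs (fun i => Real.log (x i)) hsum i
    rw [← hd, mul_comm, ← le_div_iff₀ he] at this
    exact (neg_le_neg this).trans (neg_abs_le _)
  have hle : Real.exp (-D) * (v ⬝ᵥ Q₁.1 *ᵥ v) ≤ v ⬝ᵥ Q₂.1 *ᵥ v := by
    rw [h1, h2, Finset.mul_sum]
    exact Finset.sum_le_sum fun i _ => mul_le_mul_of_nonneg_right (hxD i) (sq_nonneg _)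
  have := Real.log_le_log (mul_pos (Real.exp_pos _) p1) hle
  rw [Real.log_mul (Real.exp_pos _).ne' p1.ne', Real.log_exp] at this
  rw [mul_comm, ← le_div_iff₀ he, ← hD]
  linarith

theorem lam_one_pos {s : ℕ} (hs : 2 ≤ s) : 0 < lam s 1 := by
  have : (2 : ℝ) ≤ s := by exact_mod_cast hs
  exact Real.sqrt_pos.2 (div_pos (by norm_num) (mul_pos (by linarith) (by push_cast; linarith)))

theorem lam_one_sq {s : ℕ} (hs : 2 ≤ s) : s * (s - 1) * lam s 1 ^ 2 = 1 := by
  have h2 : (2 : ℝ) ≤ s := by exact_mod_cast hs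
  have h1 : (0 : ℝ) < s * (s - 1) := mul_pos (by linarith) (by linarith)
  rw [lam, Nat.cast_one, Real.sq_sqrt (div_nonneg zero_le_one h1.le), mul_one_div_cancel h1.ne']

theorem mu_one {s : ℕ} (hs : 2 ≤ s) : mu s 1 = (s - 1) * lam s 1 := by
  have h2 : (2 : ℝ) ≤ s := by exact_mod_cast hs
  rw [mu, Real.sqrt_eq_iff_mul_self_eq (div_nonneg (by push_cast; linarith) (by push_cast; linarith))
    (mul_nonneg (by linarith) (lam_one_pos hs).le)]
  have := lam_one_sq hs
  rw [Nat.cast_one, mul_one, div_eq_iff (by linarith)]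
  linear_combination -(s - 1 : ℝ) * this

theorem eta_eq {s : ℕ} (hs : 2 ≤ s) : eta s = s * lam s 1 := by
  have h2 : (2 : ℝ) ≤ s := by exact_mod_cast hs
  rw [eta, Real.sqrt_eq_iff_mul_self_eq (div_nonneg (by linarith) (by linarith))
    (mul_nonneg (by linarith) (lam_one_pos hs).le)]
  have := lam_one_sq hs
  rw [div_eq_iff (by linarith)]
  linear_combination -(s : ℝ) * this

theorem lam_one_add_mu_one {s : ℕ} (hs : 2 ≤ s) : lam s 1 + mu s 1 = eta s := by
  rw [mu_one hs, eta_eq hs]; ring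

/-- If `y` is within a bounded distance of `t w`, where `w` is a unit vector with one coordinate
`μ_1` and the others `-λ_1`, then the norm of `y` is governed by its large coordinate. -/
theorem sum_sq_le_of_near_ray {s : ℕ} (hs : 2 ≤ s) (y : Fin s → ℝ) (hy : ∑ i, y i = 0)
    {t β κ : ℝ} (ht : 0 ≤ t) (j : Fin s) (hlow : ∀ i, -lam s 1 * t - κ ≤ y i)
    (hj : mu s 1 * t - κ ≤ y j) (hj' : y j ≤ mu s 1 * t + β) :
    ∑ i, y i ^ 2 ≤ t ^ 2 + 2 * t * (eta s * β) + s * (s * κ) ^ 2 := by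
  have h2 : (2 : ℝ) ≤ s := by exact_mod_cast hs
  set w : Fin s → ℝ := fun i => -lam s 1 + if i = j then eta s else 0 with hw
  set z : Fin s → ℝ := fun i => y i - t * w i with hz
  have hwsum : ∑ i, w i = 0 := by
    simp only [hw, Finset.sum_add_distrib, Finset.sum_const, Finset.sum_ite_eq', Finset.card_univ,
      Fintype.card_fin, Finset.mem_univ, if_true, nsmul_eq_mul, eta_eq hs]
    ring
  have hzsum : ∑ i, z i = 0 := by
    simp only [hz, Finset.sum_sub_distrib, ← Finset.mul_sum, hwsum, hy]; simp
  have hwz : ∑ i, w i * z i = eta s * z j := by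
    simp only [hw, add_mul, Finset.sum_add_distrib, ← Finset.mul_sum, hzsum, ite_mul, zero_mul,
      Finset.sum_ite_eq', Finset.mem_univ, if_true]
    ring
  have hww : ∑ i, w i * w i = 1 := by
    have : ∀ i, w i * w i = -lam s 1 * w i + if i = j then eta s * (eta s - lam s 1) else 0 := by
      intro i
      by_cases h : i = j
      · simp only [hw, h, if_true]; ring
      · simp only [hw, h, if_false]; ring
    simp only [this, Finset.sum_add_distrib, ← Finset.mul_sum, hwsum, Finset.sum_ite_eq',
      Finset.mem_univ, if_true, eta_eq hs]
    linear_combination lam_one_sq hs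
  have hzlow : ∀ i, -κ ≤ z i := by
    intro i
    by_cases h : i = j
    · subst h
      have := lam_one_add_mu_one hs
      simp only [hz, hw, if_true]
      rw [← this]; linarith
    · simp only [hz, hw, h, if_false]
      linarith [hlow i]
  have hzj : z j ≤ β := by
    have := lam_one_add_mu_one hs
    simp only [hz, hw, if_true]
    rw [← this]; linarith
  have hκ : 0 ≤ κ := by
    have : ∑ _i : Fin s, -κ ≤ 0 := hzsum ▸ Finset.sum_le_sum fun i _ => hzlow i
    simp only [Finset.sum_const, Finset.card_univ, Fintype.card_fin, nsmul_eq_mul] at this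
    nlinarith
  have hzup : ∀ i, z i ≤ s * κ := by
    intro i
    have h1 : z i + κ ≤ ∑ i, (z i + κ) :=
      Finset.single_le_sum (f := fun i => z i + κ) (fun k _ => by linarith [hzlow k])
        (Finset.mem_univ i)
    rw [Finset.sum_add_distrib, hzsum] at h1
    simp only [Finset.sum_const, Finset.card_univ, Fintype.card_fin, nsmul_eq_mul] at h1
    linarith
  have hzsq : ∑ i, z i ^ 2 ≤ s * (s * κ) ^ 2 := by
    calc ∑ i, z i ^ 2 ≤ ∑ _i : Fin s, (s * κ) ^ 2 := Finset.sum_le_sum fun i _ => by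
          refine sq_le_sq' ?_ (hzup i)
          nlinarith [hzlow i]
      _ = _ := by simp
  have hexp : ∑ i, y i ^ 2 = t ^ 2 * ∑ i, w i * w i + 2 * t * ∑ i, w i * z i + ∑ i, z i ^ 2 := by
    simp only [Finset.mul_sum, ← Finset.sum_add_distrib]
    exact Finset.sum_congr rfl fun i _ => by simp only [hz]; ring
  rw [hexp, hww, hwz]
  have : 2 * t * (eta s * z j) ≤ 2 * t * (eta s * β) :=
    mul_le_mul_of_nonneg_left (mul_le_mul_of_nonneg_left hzj (eta_pos hs).le) (by linarith)
  linarith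

theorem inv_ray {s : ℕ} (i : ℕ) (hi : i < s) (t : ℝ) :
    (ray s i hi t).1⁻¹ = Matrix.diagonal fun k => Real.exp (-(vec s i k * t)) := by
  refine Matrix.inv_eq_left_inv ?_
  rw [ray, Matrix.diagonal_mul_diagonal, ← Matrix.diagonal_one]
  congr 1
  funext k
  rw [← Real.exp_add, neg_add_cancel, Real.exp_zero]

theorem trace_inv_ray_mul {s : ℕ} (i : ℕ) (hi : i < s) (Q : PosForm s) (t : ℝ) :
    ((ray s i hi t).1⁻¹ * Q.1).trace = ∑ k, Real.exp (-(vec s i k * t)) * Q.1 k k := by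
  rw [inv_ray, Matrix.trace]
  simp [Matrix.diagonal_mul]

theorem trace_mul_ray {s : ℕ} (i : ℕ) (hi : i < s) (A : Matrix (Fin s) (Fin s) ℝ) (t : ℝ) :
    (A * (ray s i hi t).1).trace = ∑ k, A k k * Real.exp (vec s i k * t) := by
  rw [ray, Matrix.trace]
  simp [Matrix.mul_diagonal]

theorem vec_one_last {s : ℕ} (j : Fin s) (hj : (j : ℕ) = s - 1) : vec s 1 j = -mu s 1 := by
  simp [vec, hj]

theorem vec_one_of_ne_last {s : ℕ} {j k : Fin s} (hj : (j : ℕ) = s - 1) (hk : k ≠ j) :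
    vec s 1 k = lam s 1 := by
  have : (k : ℕ) ≠ j := fun h => hk (Fin.ext h)
  rw [vec, if_pos (by omega)]

/-- The distance to the ray `r_1` is asymptotically at most `t + η ln Q(e_s)`. -/
theorem exists_formDist_ray_one_le {s : ℕ} (hs : 2 ≤ s) (Q : PosForm s) (j : Fin s)
    (hj : (j : ℕ) = s - 1) :
    ∃ g : ℝ → ℝ, Tendsto g atTop (nhds (eta s * Real.log (Q.1 j j))) ∧
      ∀ᶠ t in atTop, formDist Q (ray s 1 (by omega) t) - t ≤ g t := by
  have h2 : (2 : ℝ) ≤ s := by exact_mod_cast hs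
  have hdiag : ∀ k, 0 < Q.1 k k := fun k => Q.2.1.diag_pos
  have hdiag' : ∀ k, 0 < Q.1⁻¹ k k := fun k => Q.2.1.inv.diag_pos
  have hη := eta_pos hs
  have hl := lam_one_pos hs
  have hμ : 0 < mu s 1 := by rw [mu_one hs]; exact mul_pos (by linarith) hl
  set a := Q.1 j j with ha
  set K := ∑ k, Q.1 k k with hK
  set L := ∑ k, Q.1⁻¹ k k with hL
  have ha0 : 0 < a := hdiag j
  have hK0 : 0 < K := Finset.sum_pos (fun k _ => hdiag k) ⟨j, Finset.mem_univ j⟩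
  have hL0 : 0 < L := Finset.sum_pos (fun k _ => hdiag' k) ⟨j, Finset.mem_univ j⟩
  set κ := |Real.log L| + |Real.log (a / s)| with hκ
  set β : ℝ → ℝ := fun t => Real.log (a + K * Real.exp (-(eta s * t))) with hβ
  set M := s * (s * κ) ^ 2 with hM
  have hM0 : 0 ≤ M := by positivity
  have hβlim : Tendsto β atTop (nhds (Real.log a)) := by
    have h1 : Tendsto (fun t : ℝ => Real.exp (-(eta s * t))) atTop (nhds 0) :=
      Real.tendsto_exp_neg_atTop_nhds_zero.comp (tendsto_id.const_mul_atTop hη)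
    have h3 : Tendsto (fun t : ℝ => a + K * Real.exp (-(eta s * t))) atTop (nhds a) := by
      simpa using (h1.const_mul K).const_add a
    exact (Real.continuousAt_log ha0.ne').tendsto.comp h3
  have hglim : Tendsto (fun t => eta s * β t + M / 2 * t⁻¹) atTop
      (nhds (eta s * Real.log a)) := by
    simpa using (hβlim.const_mul (eta s)).add (tendsto_inv_atTop_zero.const_mul (M / 2))
  refine ⟨_, hglim, ?_⟩
  have hpos : ∀ᶠ t in atTop, 0 ≤ t + (eta s * β t + M / 2 * t⁻¹) :=
    (tendsto_id.atTop_add hglim).eventually_ge_atTop 0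
  filter_upwards [hpos, eventually_gt_atTop 0] with t htpos ht
  obtain ⟨x, hx, hsum, hd, -, htr1, htr2, -⟩ := exists_coefficients Q (ray s 1 (by omega) t)
  rw [trace_mul_ray] at htr1
  rw [trace_inv_ray_mul] at htr2
  have hxup : ∀ i, x i ≤ L * Real.exp (lam s 1 * t) := fun i => by
    calc x i ≤ ∑ i, x i := Finset.single_le_sum (fun k _ => (hx k).le) (Finset.mem_univ i)
      _ ≤ L * Real.exp (lam s 1 * t) := by
        rw [← htr1, hL, Finset.sum_mul]
        refine Finset.sum_le_sum fun k _ => mul_le_mul_of_nonneg_left ?_ (hdiag' k).le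
        refine Real.exp_le_exp.2 (mul_le_mul_of_nonneg_right ?_ ht.le)
        by_cases h : k = j
        · rw [h, vec_one_last j hj]; linarith
        · rw [vec_one_of_ne_last hj h]
  have hexp : Real.exp (-(lam s 1 * t)) =
      Real.exp (mu s 1 * t) * Real.exp (-(eta s * t)) := by
    rw [← Real.exp_add, ← lam_one_add_mu_one hs]; ring_nf
  have hup : ∑ i, (x i)⁻¹ ≤ Real.exp (mu s 1 * t) * (a + K * Real.exp (-(eta s * t))) := by
    rw [← htr2, ← Finset.add_sum_erase _ _ (Finset.mem_univ j), vec_one_last j hj, mul_add]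
    refine add_le_add (by rw [neg_mul, neg_neg]) ?_
    rw [mul_left_comm, ← hexp, hK, ← Finset.add_sum_erase _ _ (Finset.mem_univ j), add_mul,
      Finset.sum_mul]
    refine le_add_of_nonneg_of_le (mul_nonneg ha0.le (Real.exp_pos _).le) ?_
    refine Finset.sum_le_sum fun k hk => ?_
    rw [vec_one_of_ne_last hj (Finset.ne_of_mem_erase hk), mul_comm]
  have hlow : ∑ _i : Fin s, Real.exp (mu s 1 * t) * (a / s) ≤ ∑ i, (x i)⁻¹ := by
    rw [← htr2]
    simp only [Finset.sum_const, Finset.card_univ, Fintype.card_fin, nsmul_eq_mul]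
    calc (s : ℝ) * (Real.exp (mu s 1 * t) * (a / s))
        = Real.exp (-(vec s 1 j * t)) * Q.1 j j := by
          rw [vec_one_last j hj, neg_mul, neg_neg, ← ha]; field_simp
      _ ≤ _ := Finset.single_le_sum (f := fun k => Real.exp (-(vec s 1 k * t)) * Q.1 k k)
          (fun k _ => mul_nonneg (Real.exp_pos _).le (hdiag k).le) (Finset.mem_univ j)
  obtain ⟨i₀, -, hi₀⟩ := Finset.exists_le_of_sum_le ⟨j, Finset.mem_univ j⟩ hlow
  have hs0 : (0 : ℝ) < s := by linarith
  have key := sum_sq_le_of_near_ray hs (fun i => -Real.log (x i)) (by simp [hsum])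
    (t := t) (β := β t) (κ := κ) ht.le i₀ (fun i => by
      have := Real.log_le_log (hx i) (hxup i)
      rw [Real.log_mul hL0.ne' (Real.exp_pos _).ne', Real.log_exp] at this
      have h1 := le_abs_self (Real.log L)
      have h3 := abs_nonneg (Real.log (a / s))
      linarith) (by
      have := Real.log_le_log (mul_pos (Real.exp_pos _) (div_pos ha0 hs0)) hi₀
      rw [Real.log_mul (Real.exp_pos _).ne' (div_pos ha0 hs0).ne', Real.log_exp,
        Real.log_inv] at this
      have h1 := neg_abs_le (Real.log (a / s))
      have h3 := abs_nonneg (Real.log L)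
      linarith) (by
      have h1 : (x i₀)⁻¹ ≤ ∑ i, (x i)⁻¹ :=
        Finset.single_le_sum (fun k _ => (inv_pos.2 (hx k)).le) (Finset.mem_univ i₀)
      have := Real.log_le_log (inv_pos.2 (hx i₀)) (h1.trans hup)
      rw [Real.log_mul (Real.exp_pos _).ne' (by positivity), Real.log_exp, Real.log_inv] at this
      exact this)
  simp only [neg_sq] at key
  rw [hd, sub_le_iff_le_add', Real.sqrt_le_left htpos]
  refine key.trans ?_
  have : 2 * t * (M / 2 * t⁻¹) = M := by field_simp
  nlinarith [sq_nonneg (eta s * β t + M / 2 * t⁻¹)]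

theorem transvection_mulVec_eq_update {s : ℕ} {i k : Fin s} (h : i ≠ k) (c : ℤ) (v : Fin s → ℤ) :
    (Matrix.SpecialLinearGroup.transvection h c).1 *ᵥ v =
      Function.update v i (v i + c * v k) := by
  change Matrix.transvection i k c *ᵥ v = _
  rw [Matrix.transvection, Matrix.add_mulVec, Matrix.one_mulVec, Matrix.single_mulVec]
  funext l
  by_cases hl : l = i
  · subst hl; simp
  · simp [hl]

/-- Each integer vector can be moved to a multiple of a given basis vector by `SL(s, ℤ)`. -/
theorem exists_mulVec_eq_single {s : ℕ} (j : Fin s) (v : Fin s → ℤ) :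
    ∃ (γ : Matrix.SpecialLinearGroup (Fin s) ℤ) (d : ℤ), γ.1 *ᵥ v = Pi.single j d := by
  induction hn : ∑ i, (v i).natAbs using Nat.strong_induction_on generalizing v with
  | _ n ih =>
  subst hn
  by_cases htwo : ∃ i k, i ≠ k ∧ v k ≠ 0 ∧ (v k).natAbs ≤ (v i).natAbs
  · obtain ⟨i, k, hik, hk, hle⟩ := htwo
    obtain ⟨c, hc⟩ : ∃ c : ℤ, (v i + c * v k).natAbs < (v i).natAbs := by
      by_cases hsign : 0 < v i * v k
      · refine ⟨-1, ?_⟩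
        rcases pos_and_pos_or_neg_and_neg_of_mul_pos hsign with h | h <;> omega
      · refine ⟨1, ?_⟩
        have : v i ≠ 0 := by omega
        have h3 : v i * v k < 0 := lt_of_le_of_ne (not_lt.1 hsign) (mul_ne_zero this hk)
        rcases mul_neg_iff.1 h3 with h | h <;> omega
    have hlt : ∑ l, (Function.update v i (v i + c * v k) l).natAbs < ∑ l, (v l).natAbs := by
      refine Finset.sum_lt_sum (fun l _ => ?_) ⟨i, Finset.mem_univ i, by simpa using hc⟩
      by_cases hl : l = i
      · subst hl; simpa using hc.le
      · simp [hl]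
    obtain ⟨γ, d, hγ⟩ := ih _ hlt _ rfl
    refine ⟨γ * Matrix.SpecialLinearGroup.transvection hik c, d, ?_⟩
    rw [Matrix.SpecialLinearGroup.coe_mul, ← Matrix.mulVec_mulVec, transvection_mulVec_eq_update,
      hγ]
  · push Not at htwo
    by_cases hv : ∃ i, v i ≠ 0
    · obtain ⟨i, hi⟩ := hv
      have hsingle : ∀ k, k ≠ i → v k = 0 := fun k hk => by
        by_contra hk0
        have h1 := htwo i k hk.symm hk0
        have h2 := htwo k i hk hi
        omega
      by_cases hij : i = j
      · subst hij
        refine ⟨1, v i, ?_⟩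
        rw [Matrix.SpecialLinearGroup.coe_one, Matrix.one_mulVec]
        funext l
        by_cases hl : l = i
        · subst hl; simp
        · simp [hl, hsingle l hl]
      · refine ⟨Matrix.SpecialLinearGroup.transvection hij (-1) *
          Matrix.SpecialLinearGroup.transvection (Ne.symm hij) 1, v i, ?_⟩
        rw [Matrix.SpecialLinearGroup.coe_mul, ← Matrix.mulVec_mulVec,
          transvection_mulVec_eq_update, transvection_mulVec_eq_update]
        have hj := hsingle j (Ne.symm hij)
        funext l
        by_cases hl : l = i
        · subst hl; simp [hij, hj]
        · by_cases hlj : l = j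
          · subst hlj; simp [hl, hj]
          · simp [hl, hlj, hsingle l hl]
    · push Not at hv
      refine ⟨1, 0, ?_⟩
      rw [Matrix.SpecialLinearGroup.coe_one, Matrix.one_mulVec, Pi.single_zero]
      exact funext hv

/-- The value of a form at an integer vector. -/
noncomputable def value {s : ℕ} (Q : PosForm s) (v : Fin s → ℤ) : ℝ :=
  (fun i => (v i : ℝ)) ⬝ᵥ Q.1 *ᵥ (fun i => (v i : ℝ))

theorem intCast_ne_zero {s : ℕ} {v : Fin s → ℤ} (hv : v ≠ 0) :
    (fun i => (v i : ℝ)) ≠ 0 := fun h => hv (funext fun i => by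
  have := congrFun h i
  simpa using this)

theorem value_pos {s : ℕ} (Q : PosForm s) {v : Fin s → ℤ} (hv : v ≠ 0) : 0 < value Q v := by
  unfold value
  simpa using Q.2.1.dotProduct_mulVec_pos (intCast_ne_zero hv)

theorem value_act {s : ℕ} (Q : PosForm s) (γ : Matrix.SpecialLinearGroup (Fin s) ℤ)
    (v : Fin s → ℤ) : value (act Q (toReal s γ)) v = value Q (γ.1 *ᵥ v) := by
  have h : (fun i => ((γ.1 *ᵥ v) i : ℝ)) = (toReal s γ).1 *ᵥ (fun i => (v i : ℝ)) := by
    funext i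
    simp [toReal, Matrix.mulVec, dotProduct]
  rw [value, value, h, act, ← Matrix.mulVec_mulVec, ← Matrix.mulVec_mulVec,
    Matrix.mulVec_transpose, dotProduct_comm, ← Matrix.dotProduct_mulVec, dotProduct_comm]

theorem value_single {s : ℕ} (Q : PosForm s) (j : Fin s) (d : ℤ) :
    value Q (Pi.single j d) = d ^ 2 * Q.1 j j := by
  have h : (fun i => ((Pi.single j d : Fin s → ℤ) i : ℝ)) = Pi.single j (d : ℝ) := by
    funext i
    by_cases hi : i = j
    · subst hi; simp
    · simp [hi]
  rw [value, h]
  simp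
  ring

theorem mulVec_ne_zero {s : ℕ} (γ : Matrix.SpecialLinearGroup (Fin s) ℤ) {v : Fin s → ℤ}
    (hv : v ≠ 0) : γ.1 *ᵥ v ≠ 0 := fun h => hv <| by
  have := congrArg (fun w => (γ⁻¹).1 *ᵥ w) h
  simp only [Matrix.mulVec_mulVec, Matrix.mulVec_zero] at this
  rwa [← Matrix.SpecialLinearGroup.coe_mul, inv_mul_cancel, Matrix.SpecialLinearGroup.coe_one,
    Matrix.one_mulVec] at this

/-- A form attains its minimum on the nonzero integer vectors. -/
theorem exists_minimal_vector {s : ℕ} (hs : 2 ≤ s) (Q : PosForm s) :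
    ∃ v : Fin s → ℤ, v ≠ 0 ∧ ∀ w, w ≠ 0 → value Q v ≤ value Q w := by
  set v₀ : Fin s → ℤ := Pi.single ⟨0, by omega⟩ 1 with hv₀
  have hv₀0 : v₀ ≠ 0 := by simp [hv₀]
  set I : PosForm s := ⟨1, Matrix.PosDef.one, Matrix.det_one⟩ with hI
  set R := Real.exp (formDist I Q / eta s) * value Q v₀ with hR
  have hfin : {v : Fin s → ℤ | v ≠ 0 ∧ value Q v ≤ value Q v₀}.Finite := by
    refine (Set.finite_Icc (fun _ => -⌈R⌉) (fun _ => ⌈R⌉)).subset ?_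
    rintro v ⟨hv, hle⟩
    have h1 := eta_mul_log_sub_log_le hs I Q _ (intCast_ne_zero hv)
    change eta s * (Real.log (value I v) - Real.log (value Q v)) ≤ _ at h1
    rw [mul_comm, ← le_div_iff₀ (eta_pos hs), sub_le_iff_le_add,
      Real.log_le_iff_le_exp (value_pos I hv), Real.exp_add, Real.exp_log (value_pos Q hv)] at h1
    have h2 : value I v ≤ R := h1.trans (mul_le_mul_of_nonneg_left hle (Real.exp_pos _).le)
    have h3 : ∀ i, |v i| ≤ ⌈R⌉ := fun i => by
      have h4 : ((v i : ℝ)) ^ 2 ≤ value I v := by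
        have : value I v = ∑ i, (v i : ℝ) ^ 2 := by
          simp [value, hI, dotProduct, sq]
        rw [this]
        exact Finset.single_le_sum (f := fun i => (v i : ℝ) ^ 2) (fun _ _ => sq_nonneg _)
          (Finset.mem_univ i)
      have h5 : (|v i| : ℤ) ≤ (v i) ^ 2 := by
        rw [← sq_abs]
        exact Int.le_self_sq _
      have h6 : ((|v i| : ℤ) : ℝ) ≤ ⌈R⌉ := by
        calc ((|v i| : ℤ) : ℝ) ≤ (v i : ℝ) ^ 2 := by exact_mod_cast h5
          _ ≤ R := h4.trans h2
          _ ≤ _ := Int.le_ceil R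
      exact_mod_cast h6
    exact ⟨fun i => (abs_le.1 (h3 i)).1, fun i => (abs_le.1 (h3 i)).2⟩
  obtain ⟨v, ⟨hv, -⟩, hmin⟩ := Set.exists_min_image _ (value Q) hfin ⟨v₀, hv₀0, le_rfl⟩
  refine ⟨v, hv, fun w hw => ?_⟩
  rcases le_total (value Q w) (value Q v₀) with h | h
  · exact hmin w ⟨hw, h⟩
  · exact (hmin v₀ ⟨hv₀0, le_rfl⟩).trans h

/-- A form is equivalent to one which attains its minimum at a given basis vector. -/
theorem exists_act_apply_eq_minimum {s : ℕ} (Q : PosForm s) {v : Fin s → ℤ} (hv : v ≠ 0)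
    (hmin : ∀ w, w ≠ 0 → value Q v ≤ value Q w) (j : Fin s) :
    ∃ γ : Matrix.SpecialLinearGroup (Fin s) ℤ, (act Q (toReal s γ)).1 j j = value Q v := by
  obtain ⟨γ, d, hγ⟩ := exists_mulVec_eq_single j v
  have hd : d ≠ 0 := by
    rintro rfl
    exact mulVec_ne_zero γ hv (by rw [hγ, Pi.single_zero])
  have hv' : v = (γ⁻¹).1 *ᵥ Pi.single j d := by
    rw [← hγ, Matrix.mulVec_mulVec, ← Matrix.SpecialLinearGroup.coe_mul, inv_mul_cancel,
      Matrix.SpecialLinearGroup.coe_one, Matrix.one_mulVec]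
  have h1 : value Q v = d ^ 2 * (act Q (toReal s γ⁻¹)).1 j j := by
    rw [hv', ← value_act, value_single]
  have h2 : value Q v ≤ (act Q (toReal s γ⁻¹)).1 j j := by
    have := hmin _ (mulVec_ne_zero γ⁻¹ (v := Pi.single j 1) (by simp))
    rwa [← value_act, value_single, Int.cast_one, one_pow, one_mul] at this
  have h3 : (1 : ℝ) ≤ (d : ℝ) ^ 2 := by
    have : (1 : ℤ) ≤ d ^ 2 := by
      have := pow_pos (abs_pos.2 hd) 2
      rw [sq_abs] at this
      omega
    exact_mod_cast this
  refine ⟨γ⁻¹, le_antisymm ?_ h2⟩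
  rw [h1]
  exact le_mul_of_one_le_left (act Q (toReal s γ⁻¹)).2.1.diag_pos.le h3

theorem exists_act_eq_of_proj_eq {s : ℕ} {Q₁ Q₂ : PosForm s} (h : proj Q₁ = proj Q₂) :
    ∃ γ : Matrix.SpecialLinearGroup (Fin s) ℤ, act Q₁ (toReal s γ) = Q₂ :=
  Quotient.exact h

theorem proj_act {s : ℕ} (Q : PosForm s) (γ : Matrix.SpecialLinearGroup (Fin s) ℤ) :
    proj (act Q (toReal s γ)) = proj Q :=
  (Quotient.sound (s := formSetoid s) ⟨γ, rfl⟩ : proj Q = proj (act Q (toReal s γ))).symm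

theorem quotDist_le {s : ℕ} (Q₁ Q₂ : PosForm s) :
    quotDist (proj Q₁) (proj Q₂) ≤ formDist Q₁ Q₂ := by
  refine csInf_le ⟨0, ?_⟩ ⟨Q₁, Q₂, rfl, rfl, rfl⟩
  rintro _ ⟨_, _, -, -, rfl⟩
  exact Real.sqrt_nonneg _

theorem ray_apply_self {s : ℕ} (i : ℕ) (hi : i < s) (t : ℝ) (k : Fin s) :
    (ray s i hi t).1 k k = Real.exp (vec s i k * t) :=
  Matrix.diagonal_apply_eq _ _

theorem add_eta_mul_log_le_quotDist_ray_one {s : ℕ} (hs : 2 ≤ s) (Q : PosForm s) {v : Fin s → ℤ}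
    (hv : v ≠ 0) (hmin : ∀ w, w ≠ 0 → value Q v ≤ value Q w) (t : ℝ) :
    t + eta s * Real.log (value Q v) ≤ quotDist (proj Q) (proj (ray s 1 (by omega) t)) := by
  refine le_csInf ⟨_, Q, _, rfl, rfl, rfl⟩ ?_
  rintro _ ⟨Q₁, Q₂, h1, h2, rfl⟩
  obtain ⟨γ, rfl⟩ := exists_act_eq_of_proj_eq h1.symm
  obtain ⟨δ, rfl⟩ := exists_act_eq_of_proj_eq h2.symm
  set e : Fin s → ℤ := Pi.single ⟨s - 1, by omega⟩ 1 with he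
  set u := (δ⁻¹).1 *ᵥ e with hu
  have hu0 : u ≠ 0 := mulVec_ne_zero _ (by simp [he])
  have hδu : δ.1 *ᵥ u = e := by
    rw [hu, Matrix.mulVec_mulVec, ← Matrix.SpecialLinearGroup.coe_mul, mul_inv_cancel,
      Matrix.SpecialLinearGroup.coe_one, Matrix.one_mulVec]
  have hlip := eta_mul_log_sub_log_le hs (act Q (toReal s γ))
    (act (ray s 1 (by omega) t) (toReal s δ)) _ (intCast_ne_zero hu0)
  change eta s * (Real.log (value _ u) - Real.log (value _ u)) ≤ _ at hlip
  have h3 : value (ray s 1 (by omega) t) e = Real.exp (-(mu s 1 * t)) := by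
    rw [he, value_single, ray_apply_self, vec_one_last _ rfl]
    simp
  rw [value_act, value_act, hδu, h3, Real.log_exp] at hlip
  have h4 := Real.log_le_log (value_pos Q hv) (hmin _ (mulVec_ne_zero γ hu0))
  have h5 : eta s * mu s 1 = 1 := by
    rw [eta_eq hs, mu_one hs]
    linear_combination lam_one_sq hs
  have h6 := mul_le_mul_of_nonneg_left h4 (eta_pos hs).le
  refine le_trans ?_ hlip
  linear_combination h6 + t * h5.symm.le.antisymm h5.le

/-- The Busemann function of `r̄_1` is `η` times the logarithm of the minimum of the form on the
nonzero integer vectors. -/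
theorem fbar_one_eq {s : ℕ} (hs : 2 ≤ s) (Q : PosForm s) {v : Fin s → ℤ}
    (hv : v ≠ 0) (hmin : ∀ w, w ≠ 0 → value Q v ≤ value Q w) :
    fbar s 1 (by omega) (proj Q) = eta s * Real.log (value Q v) := by
  obtain ⟨γ, hγ⟩ := exists_act_apply_eq_minimum Q hv hmin ⟨s - 1, by omega⟩
  obtain ⟨g, hg, hle⟩ := exists_formDist_ray_one_le hs (act Q (toReal s γ)) ⟨s - 1, by omega⟩ rfl
  rw [hγ] at hg
  refine Tendsto.limUnder_eq (tendsto_of_tendsto_of_tendsto_of_le_of_le' tendsto_const_nhds hg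
    (Eventually.of_forall fun t => ?_) ?_)
  · rw [le_sub_iff_add_le']
    exact add_eta_mul_log_le_quotDist_ray_one hs Q hv hmin t
  · filter_upwards [hle] with t ht
    refine le_trans (sub_le_sub_right ?_ t) ht
    rw [← proj_act Q γ]
    exact quotDist_le _ _

/-- The inverse of a form, read in the reversed dual basis. -/
noncomputable def dual {s : ℕ} (Q : PosForm s) : PosForm s :=
  ⟨Q.1⁻¹.submatrix Fin.revPerm Fin.revPerm, Q.2.1.inv.submatrix (Equiv.injective _), by
    rw [Matrix.det_submatrix_equiv_self, Matrix.det_nonsing_inv, Q.2.2, Ring.inverse_one]⟩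

theorem isUnit_det {s : ℕ} (Q : PosForm s) : IsUnit Q.1.det := by
  rw [Q.2.2]; exact isUnit_one

theorem dual_dual {s : ℕ} (Q : PosForm s) : dual (dual Q) = Q := by
  refine Subtype.ext ?_
  simp only [dual, Matrix.inv_submatrix_equiv, Matrix.nonsing_inv_nonsing_inv _ (isUnit_det Q)]
  ext i j
  simp

theorem formDist_dual {s : ℕ} (Q₁ Q₂ : PosForm s) :
    formDist (dual Q₁) (dual Q₂) = formDist Q₁ Q₂ := by
  rw [formDist_comm Q₁ Q₂]
  simp only [formDist, dual, Matrix.inv_submatrix_equiv,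
    Matrix.nonsing_inv_nonsing_inv _ (isUnit_det Q₁), Matrix.submatrix_mul_equiv]
  rw [Matrix.charpoly_mul_comm Q₂.1⁻¹]
  have h := Matrix.charpoly_reindex (Fin.revPerm (n := s)) (Q₁.1 * Q₂.1⁻¹)
  rw [← h]
  rfl

theorem exists_dual_act {s : ℕ} (Q : PosForm s) (γ : Matrix.SpecialLinearGroup (Fin s) ℤ) :
    ∃ δ : Matrix.SpecialLinearGroup (Fin s) ℤ,
      dual (act Q (toReal s γ)) = act (dual Q) (toReal s δ) := by
  refine ⟨⟨(γ⁻¹).1ᵀ.submatrix Fin.revPerm Fin.revPerm, by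
    rw [Matrix.det_submatrix_equiv_self, Matrix.det_transpose, (γ⁻¹).2]⟩, Subtype.ext ?_⟩
  have hinv : (toReal s γ).1⁻¹ = (toReal s γ⁻¹).1 := by
    refine Matrix.inv_eq_left_inv ?_
    rw [← Matrix.SpecialLinearGroup.coe_mul, ← map_mul, inv_mul_cancel, map_one,
      Matrix.SpecialLinearGroup.coe_one]
  set M := (toReal s γ⁻¹).1 with hM
  have hδ : (toReal s ⟨(γ⁻¹).1ᵀ.submatrix Fin.revPerm Fin.revPerm, by
      rw [Matrix.det_submatrix_equiv_self, Matrix.det_transpose, (γ⁻¹).2]⟩).1 =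
      Mᵀ.submatrix Fin.revPerm Fin.revPerm := rfl
  simp only [act, dual, hδ, Matrix.mul_inv_rev, ← Matrix.transpose_nonsing_inv, hinv,
    Matrix.transpose_submatrix, Matrix.transpose_transpose, Matrix.submatrix_mul_equiv,
    Matrix.mul_assoc]

theorem proj_dual_eq {s : ℕ} {Q₁ Q₂ : PosForm s} (h : proj Q₁ = proj Q₂) :
    proj (dual Q₁) = proj (dual Q₂) := by
  obtain ⟨γ, rfl⟩ := exists_act_eq_of_proj_eq h
  obtain ⟨δ, hδ⟩ := exists_dual_act Q₁ γ
  rw [hδ, proj_act]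

theorem quotDist_dual {s : ℕ} (Q₁ Q₂ : PosForm s) :
    quotDist (proj (dual Q₁)) (proj (dual Q₂)) = quotDist (proj Q₁) (proj Q₂) := by
  unfold quotDist
  congr 1
  ext d
  constructor
  · rintro ⟨A, B, hA, hB, rfl⟩
    refine ⟨dual A, dual B, ?_, ?_, formDist_dual A B⟩
    · rw [proj_dual_eq hA, dual_dual]
    · rw [proj_dual_eq hB, dual_dual]
  · rintro ⟨A, B, hA, hB, rfl⟩
    exact ⟨dual A, dual B, proj_dual_eq hA, proj_dual_eq hB, formDist_dual A B⟩

theorem vec_last_eq {s : ℕ} (hs : 2 ≤ s) (k : Fin s) : vec s (s - 1) k = -vec s 1 k.rev := by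
  have hc : ((s - 1 : ℕ) : ℝ) = s - 1 := by rw [Nat.cast_sub (by omega), Nat.cast_one]
  have hk := k.2
  by_cases h : (k : ℕ) = 0
  · rw [vec, vec, if_pos (by omega), if_neg (by rw [Fin.val_rev]; omega), neg_neg, lam, mu, hc]
    congr 2 <;> push_cast <;> ring
  · rw [vec, vec, if_neg (by omega), if_pos (by rw [Fin.val_rev]; omega), lam, mu, hc]
    congr 3 <;> push_cast <;> ring

theorem dual_ray_last {s : ℕ} (hs : 2 ≤ s) (t : ℝ) :
    dual (ray s (s - 1) (by omega) t) = ray s 1 (by omega) t := by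
  rw [← dual_dual (ray s 1 (by omega) t)]
  congr 1
  refine Subtype.ext (Eq.symm ?_)
  simp only [dual]
  rw [inv_ray, Matrix.submatrix_diagonal_equiv, ray]
  congr 1
  funext k
  simp [vec_last_eq hs]

theorem fbar_last_eq {s : ℕ} (hs : 2 ≤ s) (Q : PosForm s) :
    fbar s (s - 1) (by omega) (proj Q) = fbar s 1 (by omega) (proj (dual Q)) := by
  unfold fbar busemann
  congr 1
  funext t
  simp only [← dual_ray_last hs, quotDist_dual]

open MeasureTheory in
/-- **Minkowski's theorem on linear forms.** -/
theorem exists_int_abs_mulVec_lt {n : ℕ} (A : Matrix (Fin n) (Fin n) ℝ) (hA : A.det ≠ 0)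
    (c : Fin n → ℝ) (hc : ∀ i, 0 < c i) (h : |A.det| < ∏ i, c i) :
    ∃ w : Fin n → ℤ, w ≠ 0 ∧ ∀ i, |(A *ᵥ fun k => (w k : ℝ)) i| < c i := by
  set b := Pi.basisFun ℝ (Fin n) with hb
  set T : Set (Fin n → ℝ) := Set.pi univ fun i => Ioo (-c i) (c i) with hT
  set S : Set (Fin n → ℝ) := Matrix.toLin' A ⁻¹' T with hS
  have fund := ZSpan.isAddFundamentalDomain' b (volume : Measure (Fin n → ℝ))
  have hvolT : volume T = ENNReal.ofReal (2 ^ n * ∏ i, c i) := by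
    rw [hT, Real.volume_pi_Ioo, ← ENNReal.ofReal_prod_of_nonneg fun i _ => by linarith [hc i]]
    congr 1
    rw [Finset.prod_congr rfl (g := fun i => 2 * c i) fun i _ => by ring, Finset.prod_mul_distrib]
    simp
  have hvolS : volume S = ENNReal.ofReal (|A.det|⁻¹ * (2 ^ n * ∏ i, c i)) := by
    rw [hS, Measure.addHaar_preimage_linearMap _ (by rwa [LinearMap.det_toLin']),
      LinearMap.det_toLin', hvolT, abs_inv, ← ENNReal.ofReal_mul (by positivity)]
  have hlt : volume (ZSpan.fundamentalDomain b) * 2 ^ Module.finrank ℝ (Fin n → ℝ) < volume S := by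
    rw [hb, ZSpan.fundamentalDomain_pi_basisFun, Real.volume_pi_Ico, hvolS]
    simp only [sub_zero, ENNReal.ofReal_one, Finset.prod_const_one, one_mul, Module.finrank_pi,
      Fintype.card_fin]
    rw [show (2 : ENNReal) ^ n = ENNReal.ofReal (2 ^ n) by
      rw [ENNReal.ofReal_pow zero_le_two]; simp]
    rw [ENNReal.ofReal_lt_ofReal_iff_of_nonneg (by positivity), ← div_eq_inv_mul,
      lt_div_iff₀ (abs_pos.2 hA)]
    exact mul_lt_mul_of_pos_left h (by positivity)
  have hconv : Convex ℝ S :=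
    (convex_pi fun i _ => convex_Ioo _ _).linear_preimage (Matrix.toLin' A)
  have hsymm : ∀ x ∈ S, -x ∈ S := by
    intro x hx i hi
    have := hx i hi
    rw [map_neg]
    exact ⟨neg_lt_neg this.2, by simpa using neg_lt_neg this.1⟩
  have : Countable (Submodule.span ℤ (Set.range b)).toAddSubgroup :=
    inferInstanceAs (Countable (Submodule.span ℤ (Set.range b)))
  obtain ⟨⟨x, hxL⟩, hx0, hxS⟩ :=
    exists_ne_zero_mem_lattice_of_measure_mul_two_pow_lt_measure fund hsymm hconv hlt
  have hint : ∀ i, ∃ m : ℤ, (m : ℝ) = x i := by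
    have := (b.mem_span_iff_repr_mem ℤ x).1 hxL
    intro i
    simpa [hb] using this i
  choose w hw using hint
  have hwx : (fun k => (w k : ℝ)) = x := funext hw
  refine ⟨w, ?_, fun i => ?_⟩
  · rintro rfl
    refine hx0 (Subtype.ext ?_)
    change x = 0
    rw [← hwx]
    funext k
    simp
  · rw [hwx]
    exact abs_lt.2 (hxS i (mem_univ i))

/-- A unit vector is a row of an orthogonal matrix. -/
theorem exists_orthogonal_row {n : ℕ} (j : Fin n) (u : Fin n → ℝ) (hu : u ⬝ᵥ u = 1) :
    ∃ O : Matrix (Fin n) (Fin n) ℝ, Oᵀ * O = 1 ∧ O j = u := by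
  have horth : Orthonormal ℝ (({j} : Set (Fin n)).domRestrict
      fun _ => (WithLp.toLp 2 u : EuclideanSpace ℝ (Fin n))) := by
    constructor
    · intro i
      have : ‖(WithLp.toLp 2 u : EuclideanSpace ℝ (Fin n))‖ ^ 2 = 1 := by
        rw [EuclideanSpace.real_norm_sq_eq, ← hu]
        simp [dotProduct, sq]
      exact (pow_eq_one_iff_of_nonneg (norm_nonneg _) two_ne_zero).1 this
    · intro i k hik
      exact absurd (Subsingleton.elim i k) hik
  obtain ⟨b, hb⟩ := horth.exists_orthonormalBasis_extension_of_card_eq (by simp)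
  refine ⟨Matrix.of fun i k => b i k, mul_eq_one_comm.1 ?_, ?_⟩
  · ext i k
    have h := orthonormal_iff_ite.1 b.orthonormal i k
    rw [Matrix.one_apply, ← h]
    simp [Matrix.mul_apply, PiLp.inner_apply, mul_comm]
  · funext k
    simp [hb j rfl]

/-- A form and its inverse take values at integer vectors which are related by transference. -/
theorem exists_inverse_value_le {s : ℕ} (hs : 2 ≤ s) (Q : PosForm s) {v : Fin s → ℤ}
    (hv : v ≠ 0) : ∃ w : Fin s → ℤ, w ≠ 0 ∧
      (fun i => (w i : ℝ)) ⬝ᵥ Q.1⁻¹ *ᵥ (fun i => (w i : ℝ)) ≤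
        (s - 1) * Real.exp ((Real.log 4 + Real.log (value Q v)) / (s - 1)) := by
  have h2 : (2 : ℝ) ≤ s := by exact_mod_cast hs
  have hs1 : (0 : ℝ) < s - 1 := by linarith
  obtain ⟨P, x, -, h1, -⟩ := exists_simultaneous_diagonalization Q Q
  have hdetP : P.det * P.det = 1 := by
    have := congrArg Matrix.det h1
    simpa [Matrix.det_mul, Q.2.2] using this
  have hPdet : IsUnit P.det := IsUnit.of_mul_eq_one _ hdetP
  have hPP : P * P⁻¹ = 1 := Matrix.mul_nonsing_inv P hPdet
  have hT : (P⁻¹)ᵀ * Pᵀ = 1 := by rw [← Matrix.transpose_mul, hPP, Matrix.transpose_one]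
  have hinv : Q.1⁻¹ = P * Pᵀ := by
    refine Matrix.inv_eq_right_inv ?_
    have : Pᵀ * (Q.1 * P) = 1 := by rw [← Matrix.mul_assoc, h1]
    rw [← Matrix.mul_assoc]
    exact mul_eq_one_comm.1 this
  have hQ : Q.1 = (P⁻¹)ᵀ * P⁻¹ := by
    calc Q.1 = ((P⁻¹)ᵀ * Pᵀ) * Q.1 * (P * P⁻¹) := by rw [hT, hPP]; simp
      _ = (P⁻¹)ᵀ * (Pᵀ * Q.1 * P) * P⁻¹ := by simp only [Matrix.mul_assoc]
      _ = _ := by rw [h1]; simp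
  set a := value Q v with ha
  have ha0 : 0 < a := value_pos Q hv
  set r := Real.sqrt a with hr
  have hr0 : 0 < r := Real.sqrt_pos.2 ha0
  set vR : Fin s → ℝ := fun i => (v i : ℝ) with hvR
  set u := P⁻¹ *ᵥ vR with hu
  have huu : u ⬝ᵥ u = a := by
    rw [ha, value, hQ, ← Matrix.mulVec_mulVec, Matrix.mulVec_transpose,
      dotProduct_comm _ (_ ᵥ* _), ← Matrix.dotProduct_mulVec]
  obtain ⟨O, hO, hOj⟩ := exists_orthogonal_row ⟨0, by omega⟩ (r⁻¹ • u) (by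
    rw [smul_dotProduct, dotProduct_smul, huu, smul_eq_mul, smul_eq_mul, ← Real.sq_sqrt ha0.le,
      ← hr]
    field_simp)
  set j : Fin s := ⟨0, by omega⟩ with hj
  set ρ := Real.exp ((Real.log 4 + Real.log a) / (s - 1) / 2) with hρ
  have hρsq : ρ ^ 2 = Real.exp ((Real.log 4 + Real.log a) / (s - 1)) := by
    rw [hρ, ← Real.exp_nat_mul]; congr 1; push_cast; ring
  have hρpow : ρ ^ (s - 1) = 2 * r := by
    have h3 : (ρ ^ (s - 1)) ^ 2 = (2 * r) ^ 2 := by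
      rw [← pow_mul, mul_comm, pow_mul, hρsq, ← Real.exp_nat_mul, Nat.cast_sub (by omega),
        Nat.cast_one, mul_div_cancel₀ _ hs1.ne', Real.exp_add, Real.exp_log (by norm_num),
        Real.exp_log ha0, mul_pow, hr, Real.sq_sqrt ha0.le]
      norm_num
    exact (pow_left_inj₀ (by positivity) (by positivity) two_ne_zero).1 h3
  set c : Fin s → ℝ := fun i => if i = j then r⁻¹ else ρ with hc
  have hcprod : ∏ i, c i = 2 := by
    rw [← Finset.mul_prod_erase _ _ (Finset.mem_univ j),
      Finset.prod_congr rfl (g := fun _ => ρ) fun i hi => by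
        rw [hc]; exact if_neg (Finset.ne_of_mem_erase hi), Finset.prod_const,
      Finset.card_erase_of_mem (Finset.mem_univ j), Finset.card_univ, Fintype.card_fin, hρpow]
    simp only [hc, if_true]
    field_simp
  have hdetO : O.det * O.det = 1 := by
    have := congrArg Matrix.det hO
    simpa [Matrix.det_mul] using this
  have hdetsq : (O * Pᵀ).det * (O * Pᵀ).det = 1 := by
    rw [Matrix.det_mul, Matrix.det_transpose, mul_mul_mul_comm, hdetO, hdetP, one_mul]
  have hdet : |(O * Pᵀ).det| = 1 := by
    rcases mul_self_eq_one_iff.1 hdetsq with h | h <;> rw [h] <;> simp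
  obtain ⟨w, hw, hwlt⟩ := exists_int_abs_mulVec_lt (O * Pᵀ)
    (fun h => by rw [h] at hdet; simp at hdet) c
    (fun i => by
      simp only [hc]
      split_ifs
      · exact inv_pos.2 hr0
      · exact Real.exp_pos _) (by rw [hdet, hcprod]; norm_num)
  set wR : Fin s → ℝ := fun k => (w k : ℝ) with hwR
  set z := (O * Pᵀ) *ᵥ wR with hz
  have hzj : z j = r⁻¹ * (vR ⬝ᵥ wR) := by
    have h3 : z j = O j ⬝ᵥ (Pᵀ *ᵥ wR) := by rw [hz, ← Matrix.mulVec_mulVec]; rfl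
    rw [h3, hOj, smul_dotProduct, smul_eq_mul, Matrix.dotProduct_mulVec, Matrix.vecMul_transpose,
      hu, Matrix.mulVec_mulVec, hPP, Matrix.one_mulVec]
  have hvw : vR ⬝ᵥ wR = 0 := by
    have h3 := hwlt j
    rw [hzj, abs_mul, abs_of_pos (inv_pos.2 hr0)] at h3
    simp only [hc, if_true] at h3
    have h4 : |vR ⬝ᵥ wR| < 1 := by
      by_contra hcon
      exact absurd h3 (not_lt.2 (le_mul_of_one_le_right (inv_pos.2 hr0).le (not_lt.1 hcon)))
    have h5 : vR ⬝ᵥ wR = ((∑ i, v i * w i : ℤ) : ℝ) := by simp [dotProduct, hvR, hwR]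
    rw [h5] at h4 ⊢
    have h6 : |∑ i, v i * w i| < 1 := by exact_mod_cast h4
    rw [Int.abs_lt_one_iff.1 h6, Int.cast_zero]
  refine ⟨w, hw, ?_⟩
  have hval : wR ⬝ᵥ Q.1⁻¹ *ᵥ wR = ∑ i, z i ^ 2 := by
    have h3 : Q.1⁻¹ = (O * Pᵀ)ᵀ * (O * Pᵀ) := by
      rw [hinv, Matrix.transpose_mul, Matrix.transpose_transpose, Matrix.mul_assoc,
        ← Matrix.mul_assoc Oᵀ, hO, Matrix.one_mul]
    rw [h3, ← Matrix.mulVec_mulVec, Matrix.mulVec_transpose,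
      dotProduct_comm _ (_ ᵥ* _), ← Matrix.dotProduct_mulVec, ← hz]
    simp [dotProduct, sq]
  rw [hval, ← hρsq, ← Finset.add_sum_erase _ _ (Finset.mem_univ j), hzj, hvw, mul_zero,
    zero_pow two_ne_zero, zero_add]
  calc ∑ i ∈ Finset.univ.erase j, z i ^ 2 ≤ ∑ i ∈ Finset.univ.erase j, ρ ^ 2 := by
        refine Finset.sum_le_sum fun i hi => ?_
        have h3 := hwlt i
        simp only [hc, if_neg (Finset.ne_of_mem_erase hi)] at h3
        rw [← sq_abs]
        exact pow_le_pow_left₀ (abs_nonneg _) h3.le 2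
    _ = (s - 1) * ρ ^ 2 := by
        rw [Finset.sum_const, Finset.card_erase_of_mem (Finset.mem_univ j), Finset.card_univ,
          Fintype.card_fin, nsmul_eq_mul, Nat.cast_sub (by omega), Nat.cast_one]

theorem value_dual {s : ℕ} (Q : PosForm s) (w : Fin s → ℤ) :
    value (dual Q) (w ∘ Fin.revPerm) =
      (fun i => (w i : ℝ)) ⬝ᵥ Q.1⁻¹ *ᵥ (fun i => (w i : ℝ)) := by
  have h : (fun i => ((w ∘ Fin.revPerm) i : ℝ)) = (fun i => (w i : ℝ)) ∘ Fin.revPerm := rfl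
  rw [value, h, dual, Matrix.submatrix_mulVec_equiv, Function.comp_assoc, Equiv.self_comp_symm,
    Function.comp_id, comp_equiv_dotProduct_comp_equiv]

/-- **Transference** between the Busemann functions of `r̄_1` and `r̄_{s-1}`. -/
theorem exists_fbar_dual_le {s : ℕ} (hs : 2 ≤ s) :
    ∃ C : ℝ, ∀ Q : PosForm s, fbar s 1 (by omega) (proj (dual Q)) ≤
      C + 1 / ((s : ℝ) - 1) * fbar s 1 (by omega) (proj Q) := by
  have h2 : (2 : ℝ) ≤ s := by exact_mod_cast hs
  have hs1 : (0 : ℝ) < s - 1 := by linarith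
  refine ⟨eta s * (Real.log (s - 1) + Real.log 4 / (s - 1)), fun Q => ?_⟩
  obtain ⟨v, hv, hvmin⟩ := exists_minimal_vector hs Q
  obtain ⟨u, hu, humin⟩ := exists_minimal_vector hs (dual Q)
  obtain ⟨w, hw, hle⟩ := exists_inverse_value_le hs Q hv
  rw [← value_dual] at hle
  have hw' : w ∘ Fin.revPerm ≠ 0 := fun h => hw (funext fun i => by
    simpa using congrFun h (Fin.revPerm i))
  rw [fbar_one_eq hs Q hv hvmin, fbar_one_eq hs (dual Q) hu humin]
  have h := Real.log_le_log (value_pos _ hu) ((humin _ hw').trans hle)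
  rw [Real.log_mul hs1.ne' (Real.exp_pos _).ne', Real.log_exp] at h
  refine (mul_le_mul_of_nonneg_left h (eta_pos hs).le).trans (le_of_eq ?_)
  ring

theorem alpha_one {s : ℕ} (hs : 2 ≤ s) (m : ℕ) (h1 : 1 ≤ m) (hm : m < s) :
    alpha s m 1 = eta s * mu s m := by
  set j : Fin s := ⟨s - 1, by omega⟩ with hj
  have hvec : ∀ k, vec s 1 k = lam s 1 - if k = j then eta s else 0 := fun k => by
    split_ifs with h
    · rw [h, vec_one_last j rfl, ← lam_one_add_mu_one hs]; ring
    · rw [vec_one_of_ne_last (j := j) rfl h, sub_zero]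
  have hlast : vec s m j = -mu s m := if_neg (by rw [hj]; simp only; omega)
  simp only [alpha, dotProduct, hvec, sub_mul, Finset.sum_sub_distrib, ← Finset.mul_sum,
    sum_vec s m hm, ite_mul, zero_mul, Finset.sum_ite_eq', Finset.mem_univ, if_true, hlast]
  ring

theorem alpha_last {s : ℕ} (hs : 2 ≤ s) (m : ℕ) (hm : m < s) :
    alpha s m (s - 1) = eta s * lam s m := by
  set j : Fin s := ⟨0, by omega⟩ with hj
  have hvec : ∀ k, vec s (s - 1) k = (if k = j then eta s else 0) - lam s 1 := fun k => by
    rw [vec_last_eq hs]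
    split_ifs with h
    · rw [h, vec_one_last _ (by rw [hj, Fin.val_rev]), ← lam_one_add_mu_one hs]; ring
    · rw [vec_one_of_ne_last (j := ⟨s - 1, by omega⟩) rfl, zero_sub]
      intro hk
      have h3 := congrArg Fin.val hk
      rw [Fin.val_rev] at h3
      have hk0 : (k : ℕ) ≠ 0 := fun h4 => h (Fin.ext h4)
      simp only at h3
      omega
  have hfirst : vec s m j = lam s m := if_pos (by rw [hj]; simp only; omega)
  simp only [alpha, dotProduct, hvec, sub_mul, Finset.sum_sub_distrib, ← Finset.mul_sum,
    sum_vec s m hm, ite_mul, zero_mul, Finset.sum_ite_eq', Finset.mem_univ, if_true, hfirst]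
  ring

end Transference

theorem lemma3p2p3 (s : ℕ) (hs : 2 ≤ s) :
    (∃ C : ℝ, ∀ (m : ℕ) (_ : 1 ≤ m) (hm : m < s) (a b : ℝ) (φ : ℝ → ℝ),
      Set.MapsTo φ (Set.Ici a) (Set.Ici b) → StrictMonoOn φ (Set.Ici a) →
      Transference.ascending s m hm 1 (by omega) φ ⊆
        Transference.ascending s m hm (s - 1) (by omega) (fun t =>
          Transference.eta s *
              (Transference.lam s m - Transference.mu s m / ((s : ℝ) - 1)) * t
            + 1 / ((s : ℝ) - 1) * φ t + C)) ∧
    (∃ C : ℝ, ∀ (m : ℕ) (_ : 1 ≤ m) (hm : m < s) (a' b' : ℝ) (ψ : ℝ → ℝ),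
      Set.MapsTo ψ (Set.Ici a') (Set.Ici b') → StrictMonoOn ψ (Set.Ici a') →
      Transference.ascending s m hm (s - 1) (by omega) ψ ⊆
        Transference.ascending s m hm 1 (by omega) (fun t =>
          Transference.eta s *
              (Transference.mu s m - Transference.lam s m / ((s : ℝ) - 1)) * t
            + 1 / ((s : ℝ) - 1) * ψ t + C)) := by
  obtain ⟨C, hC⟩ := Transference.exists_fbar_dual_le hs
  have h2 : (2 : ℝ) ≤ s := by exact_mod_cast hs
  have hs1 : (0 : ℝ) ≤ 1 / ((s : ℝ) - 1) := one_div_nonneg.2 (by linarith)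
  refine ⟨⟨C, fun m h1 hm a b φ _ _ u hu => ⟨hu.1, hu.2.mono fun t ht => ?_⟩⟩,
    ⟨C, fun m h1 hm a b ψ _ _ u hu => ⟨hu.1, hu.2.mono fun t ht => ?_⟩⟩⟩
  · have h := hC (Transference.act (Transference.ray s m hm t) u)
    rw [Transference.alpha_one hs m h1 hm] at ht
    rw [Transference.alpha_last hs m hm, Transference.fbar_last_eq hs]
    have h3 := mul_le_mul_of_nonneg_left ht hs1
    simp only [div_eq_mul_inv, one_mul] at h h3 ⊢
    linarith
  · have h := hC (Transference.dual (Transference.act (Transference.ray s m hm t) u))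
    rw [Transference.dual_dual] at h
    rw [Transference.alpha_last hs m hm, Transference.fbar_last_eq hs] at ht
    rw [Transference.alpha_one hs m h1 hm]
    have h3 := mul_le_mul_of_nonneg_left ht hs1
    simp only [div_eq_mul_inv, one_mul] at h h3 ⊢
    linarith
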